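/- Let $X$ be a measurable space, $X_0\subset X$ a measurable set, $\mathcal H_1,\mathcal H_2$ complex Hilbert spaces, and let $F$ be a (weakly countably additive) measure on $X$ whose values are positive operators on $\mathcal H_1$, with $F(X)\le 1$. For bounded measurable $g:X\to\mathbb C$ write $F[g]=\int F(dx)\,g(x)$. Let $s=+1$ (Bose case) or $s=-1$ (Fermi case). Say that a bounded operator $W:\mathcal H_2\to\mathcal H_1$ satisfies the localization conditions if $\operatorname{tr} W^*F(X_0)W<\infty$ and, in the case $s=-1$, also $\|W\|<1$. For such $W$ the associated characteristic function is $$C_W(f)=\det\bigl(1-s\,W^*F[e^{if}-1]\,W\bigr)^{-s},$$ where $\det$ is the Fredholm determinant and $f$ ranges over the measurable functions $f:X\to\mathbb R$ vanishing outside $X_0$. Suppose that $W_0:\mathcal H_2\to\mathcal H_1$ satisfies the localization conditions. Let $W_\infty$ and $W_\alpha$ ($\alpha$ in the index set of a net) be bounded operators $\mathcal H_2\to\mathcal H_1$ such that $W_\alpha^*\to W_\infty^*$ strongly and $W_\alpha W_\alpha^*\le W_0W_0^*$ for all $\alpha$. Then $W_\infty$ and every $W_\alpha$ satisfy the localization conditions;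 their characteristic functions $C_\infty=C_{W_\infty}$ and $C_\alpha=C_{W_\alpha}$ are well defined (the Fredholm determinants exist, and for $s=+1$ they are nonzero); and $$C_\infty(f)=\lim_\alpha C_\alpha(f)$$ uniformly over all measurable $f:X\to\mathbb R$ vanishing outside $X_0$. -/

import Mathlib

open Filter Topology MeasureTheory
open scoped ComplexOrder

/-- A (subnormalized) positive operator valued measure on the measurable space `X`: its values on
measurable sets are positive operators on the Hilbert space `H`, it is countably additive in the
weak sense (for positive operators this is the same as strong countable additivity), and the value
on the whole space is at most the identity. Values on non-measurable sets are irrelevant. -/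
structure POVM (X : Type*) [MeasurableSpace X] (H : Type*) [NormedAddCommGroup H]
    [InnerProductSpace ℂ H] where
  /-- the operator `F(S)` -/
  toFun : Set X → (H →L[ℂ] H)
  isPositive : ∀ S, MeasurableSet S → (toFun S).IsPositive
  hasSum : ∀ A : ℕ → Set X, (∀ n, MeasurableSet (A n)) → Pairwise (Function.onFun Disjoint A) →
    ∀ φ ψ : H, HasSum (fun n => inner ℂ φ (toFun (A n) ψ)) (inner ℂ φ (toFun (⋃ n, A n) ψ))
  le_one : toFun Set.univ ≤ 1

namespace POVM

section

variable {X : Type*} [MeasurableSpace X] {H : Type*} [NormedAddCommGroup H]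
  [InnerProductSpace ℂ H] (F : POVM X H)

theorem empty_apply (φ ψ : H) : inner ℂ φ (F.toFun ∅ ψ) = (0 : ℂ) := by
  have h := F.hasSum (fun _ => ∅) (fun _ => MeasurableSet.empty)
    (fun i j _ => by simp [Function.onFun]) φ ψ
  exact tendsto_nhds_unique tendsto_const_nhds h.summable.tendsto_atTop_zero

theorem re_nonneg {S : Set X} (hS : MeasurableSet S) (ψ : H) :
    0 ≤ (inner ℂ ψ (F.toFun S ψ)).re :=
  (F.isPositive S hS).re_inner_nonneg_right ψ

theorem inner_eq_re {S : Set X} (hS : MeasurableSet S) (ψ : H) :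
    inner ℂ ψ (F.toFun S ψ) = (((inner ℂ ψ (F.toFun S ψ)).re : ℝ) : ℂ) :=
  Complex.ext rfl (by
    simpa using (Complex.nonneg_iff.mp ((F.isPositive S hS).inner_nonneg_right ψ)).2.symm)

/-- The measure `S ↦ ⟨ψ, F(S) ψ⟩`. -/
noncomputable def quadMeasure (ψ : H) : Measure X :=
  Measure.ofMeasurable (fun S _ => ENNReal.ofReal (inner ℂ ψ (F.toFun S ψ)).re)
    (by simp [F.empty_apply])
    (by
      intro A hA hd
      have h := Complex.hasSum_re (F.hasSum A hA hd ψ ψ)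
      rw [← h.tsum_eq]
      exact ENNReal.ofReal_tsum_of_nonneg (fun n => F.re_nonneg (hA n) ψ) h.summable)

theorem quadMeasure_apply (ψ : H) {S : Set X} (hS : MeasurableSet S) :
    F.quadMeasure ψ S = ENNReal.ofReal (inner ℂ ψ (F.toFun S ψ)).re :=
  Measure.ofMeasurable_apply S hS

instance (ψ : H) : IsFiniteMeasure (F.quadMeasure ψ) :=
  ⟨by rw [F.quadMeasure_apply ψ MeasurableSet.univ]; exact ENNReal.ofReal_lt_top⟩

theorem quadMeasure_univ_le (ψ : H) : (F.quadMeasure ψ).real Set.univ ≤ ‖ψ‖ ^ 2 := by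
  rw [measureReal_def, F.quadMeasure_apply ψ MeasurableSet.univ,
    ENNReal.toReal_ofReal (F.re_nonneg MeasurableSet.univ ψ)]
  have h := ((ContinuousLinearMap.le_def _ _).mp F.le_one).re_inner_nonneg_right ψ
  simp only [sub_apply, one_apply_eq_self, inner_sub_right,
    map_sub, inner_self_eq_norm_sq] at h
  simpa using h

/-- Simple functions have an operator valued integral. -/
theorem exists_integral_simple (g : SimpleFunc X ℂ) :
    ∃ T : H →L[ℂ] H, ∀ ψ, inner ℂ ψ (T ψ) = ∫ x, g x ∂(F.quadMeasure ψ) := by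
  induction g using SimpleFunc.induction with
  | const c hs =>
    rename_i s
    refine ⟨c • F.toFun s, fun ψ => ?_⟩
    have : (fun x => (SimpleFunc.piecewise s hs (SimpleFunc.const X c) (SimpleFunc.const X 0)) x)
        = s.indicator (fun _ => c) := by
      funext x
      by_cases hx : x ∈ s <;> simp [hx]
    rw [this, integral_indicator_const _ hs, measureReal_def, F.quadMeasure_apply ψ hs,
      ENNReal.toReal_ofReal (F.re_nonneg hs ψ)]
    rw [smul_apply, inner_smul_right, F.inner_eq_re hs ψ]
    simp [mul_comm]
  | add hd hf hg =>
    obtain ⟨S, hS⟩ := hf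
    obtain ⟨T, hT⟩ := hg
    refine ⟨S + T, fun ψ => ?_⟩
    simp only [SimpleFunc.coe_add, Pi.add_apply, add_apply, inner_add_right]
    rw [integral_add, hS, hT]
    · exact SimpleFunc.integrable_of_isFiniteMeasure _
    · exact SimpleFunc.integrable_of_isFiniteMeasure _

variable [CompleteSpace H]

/-- Bounded measurable functions have an operator valued integral. -/
theorem exists_integral {g : X → ℂ} (hg : Measurable g) {c : ℝ} (hc : ∀ x, ‖g x‖ ≤ c) :
    ∃ T : H →L[ℂ] H, ∀ ψ, inner ℂ ψ (T ψ) = ∫ x, g x ∂(F.quadMeasure ψ) := by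
  have hsm : StronglyMeasurable g := hg.stronglyMeasurable
  choose T hT using fun n => F.exists_integral_simple (hsm.approxBounded (max c 0) n)
  set q : H → ℂ := fun ψ => ∫ x, g x ∂(F.quadMeasure ψ) with hq
  have hlim : ∀ ψ, Tendsto (fun n => inner ℂ ψ (T n ψ)) atTop (𝓝 (q ψ)) := by
    intro ψ
    simp only [hT]
    refine tendsto_integral_of_dominated_convergence (fun _ => max c 0)
      (fun n => (SimpleFunc.stronglyMeasurable _).aestronglyMeasurable) (integrable_const _)
      (fun n => Eventually.of_forall fun x =>
        hsm.norm_approxBounded_le (le_max_right _ _) n x)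
      (Eventually.of_forall fun x =>
        hsm.tendsto_approxBounded_of_norm_le ((hc x).trans (le_max_left _ _)))
  have hqb : ∀ ψ, ‖q ψ‖ ≤ max c 0 * ‖ψ‖ ^ 2 := by
    intro ψ
    refine (norm_integral_le_of_norm_le_const (C := max c 0)
      (Eventually.of_forall fun x => (hc x).trans (le_max_left c 0))).trans ?_
    exact mul_le_mul_of_nonneg_left (F.quadMeasure_univ_le ψ) (le_max_right _ _)
  -- polarization
  set B : H → H → ℂ := fun φ ψ =>
    (q (φ + ψ) - q (φ - ψ) - Complex.I * q (φ + Complex.I • ψ)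
      + Complex.I * q (φ - Complex.I • ψ)) / 4 with hB
  have hpol : ∀ (S : H →L[ℂ] H) (φ ψ : H), inner ℂ φ (S ψ) =
      (inner ℂ (φ + ψ) (S (φ + ψ)) - inner ℂ (φ - ψ) (S (φ - ψ))
        - Complex.I * inner ℂ (φ + Complex.I • ψ) (S (φ + Complex.I • ψ))
        + Complex.I * inner ℂ (φ - Complex.I • ψ) (S (φ - Complex.I • ψ))) / 4 := by
    intro S φ ψ
    have hI : Complex.I * Complex.I = -1 := Complex.I_mul_I
    simp only [map_add, map_sub, map_smul, inner_add_left, inner_add_right, inner_sub_left,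
      inner_sub_right, inner_smul_left, inner_smul_right, Complex.conj_I]
    ring_nf
    simp only [Complex.I_sq]
    ring
  have hBlim : ∀ φ ψ, Tendsto (fun n => inner ℂ φ (T n ψ)) atTop (𝓝 (B φ ψ)) := by
    intro φ ψ
    simp only [hpol _ φ ψ]
    exact ((((hlim _).sub (hlim _)).sub ((hlim _).const_mul _)).add
      ((hlim _).const_mul _)).div_const _
  have hBb : ∀ φ ψ, ‖B φ ψ‖ ≤ max c 0 * (‖φ‖ + ‖ψ‖) ^ 2 := by
    intro φ ψ
    have h0 : (0 : ℝ) ≤ max c 0 := le_max_right _ _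
    have key : ∀ χ : H, ‖χ‖ ≤ ‖φ‖ + ‖ψ‖ → ‖q χ‖ ≤ max c 0 * (‖φ‖ + ‖ψ‖) ^ 2 := fun χ h =>
      (hqb χ).trans (by gcongr)
    have h1 := key (φ + ψ) (norm_add_le _ _)
    have h2 := key (φ - ψ) (norm_sub_le _ _)
    have h3 := key (φ + Complex.I • ψ) ((norm_add_le _ _).trans (by simp [norm_smul]))
    have h4 := key (φ - Complex.I • ψ) ((norm_sub_le _ _).trans (by simp [norm_smul]))
    simp only [hB, norm_div]
    rw [div_le_iff₀ (by norm_num)]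
    refine (norm_add_le _ _).trans ?_
    refine (add_le_add_left (norm_sub_le _ _) _).trans ?_
    refine (add_le_add_left (add_le_add_left (norm_sub_le _ _) _) _).trans ?_
    simp only [norm_mul, Complex.norm_I, one_mul, Complex.norm_ofNat]
    linarith
  have hadd_left : ∀ φ φ' ψ, B (φ + φ') ψ = B φ ψ + B φ' ψ := fun φ φ' ψ =>
    tendsto_nhds_unique (hBlim _ _)
      (by simpa only [inner_add_left] using (hBlim φ ψ).add (hBlim φ' ψ))
  have hsmul_left : ∀ (a : ℂ) φ ψ, B (a • φ) ψ = (starRingEnd ℂ) a * B φ ψ := fun a φ ψ =>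
    tendsto_nhds_unique (hBlim _ _)
      (by simpa only [inner_smul_left] using (hBlim φ ψ).const_mul _)
  have hadd_right : ∀ φ ψ ψ', B φ (ψ + ψ') = B φ ψ + B φ ψ' := fun φ ψ ψ' =>
    tendsto_nhds_unique (hBlim _ _)
      (by simpa only [map_add, inner_add_right] using (hBlim φ ψ).add (hBlim φ ψ'))
  have hsmul_right : ∀ (a : ℂ) φ ψ, B φ (a • ψ) = a * B φ ψ := fun a φ ψ =>
    tendsto_nhds_unique (hBlim _ _)
      (by simpa only [map_smul, inner_smul_right] using (hBlim φ ψ).const_mul _)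
  have hBb' : ∀ φ ψ, ‖B φ ψ‖ ≤ 4 * max c 0 * ‖φ‖ * ‖ψ‖ := by
    intro φ ψ
    rcases eq_or_ne φ 0 with rfl | hφ
    · have : B 0 ψ = 0 := by simpa using hsmul_left 0 0 ψ
      simp [this]
    rcases eq_or_ne ψ 0 with rfl | hψ
    · have : B φ 0 = 0 := by simpa using hsmul_right 0 φ 0
      simp [this]
    have hφ' : ‖φ‖ ≠ 0 := norm_ne_zero_iff.mpr hφ
    have hψ' : ‖ψ‖ ≠ 0 := norm_ne_zero_iff.mpr hψ
    have h := hBb (((‖φ‖⁻¹ : ℝ) : ℂ) • φ) (((‖ψ‖⁻¹ : ℝ) : ℂ) • ψ)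
    rw [hsmul_left, hsmul_right] at h
    simp only [norm_mul, norm_smul, RCLike.norm_conj, Complex.norm_real, norm_inv, norm_norm,
      inv_mul_cancel₀ hφ', inv_mul_cancel₀ hψ'] at h
    have h2 := mul_le_mul_of_nonneg_left h (mul_nonneg (norm_nonneg φ) (norm_nonneg ψ))
    have e : ‖φ‖ * ‖ψ‖ * (‖φ‖⁻¹ * (‖ψ‖⁻¹ * ‖B φ ψ‖)) = ‖B φ ψ‖ := by field_simp
    rw [e] at h2
    linarith
  -- the adjoint form is continuous sesquilinear; represent it by an operator
  let L : H →L⋆[ℂ] H →L[ℂ] ℂ :=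
    LinearMap.mkContinuous₂ (LinearMap.mk₂'ₛₗ (starRingEnd ℂ) (RingHom.id ℂ) B
      hadd_left (fun a φ ψ => by simpa using hsmul_left a φ ψ) hadd_right
      (fun a φ ψ => by simpa using hsmul_right a φ ψ)) (4 * max c 0) hBb'
  refine ⟨ContinuousLinearMap.adjoint (InnerProductSpace.continuousLinearMapOfBilin L),
    fun ψ => ?_⟩
  rw [ContinuousLinearMap.adjoint_inner_right, InnerProductSpace.continuousLinearMapOfBilin_apply]
  exact tendsto_nhds_unique (hBlim ψ ψ) (hlim ψ)

open Classical in
/-- The operator valued integral `F[g] = ∫ F(dx) g(x)` of a bounded measurable function `g`, i.e.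
the bounded operator (unique by polarization) with `⟨ψ, F[g] ψ⟩ = ∫ g(x) ⟨ψ, F(dx) ψ⟩` for all
`ψ`; it is set to `0` if there is no such operator. -/
noncomputable def integral (g : X → ℂ) : H →L[ℂ] H :=
  if h : ∃ T : H →L[ℂ] H, ∀ ψ, inner ℂ ψ (T ψ) = ∫ x, g x ∂(F.quadMeasure ψ) then h.choose else 0

theorem inner_integral {g : X → ℂ} (hg : Measurable g) {c : ℝ} (hc : ∀ x, ‖g x‖ ≤ c) (ψ : H) :
    inner ℂ ψ (F.integral g ψ) = ∫ x, g x ∂(F.quadMeasure ψ) := by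
  have h := F.exists_integral hg hc
  rw [integral, dif_pos h]
  exact h.choose_spec ψ

end

end POVM

/-- For a positive operator `T`: the trace of `T` is finite, i.e. the series `∑ ⟨e i, T e i⟩` of
nonnegative terms converges for orthonormal bases `e`. (Up to a change of the index set, every
Hilbert basis is indexed by a subset of `H`.) -/
def HasFiniteTrace {H : Type*} [NormedAddCommGroup H] [InnerProductSpace ℂ H]
    (T : H →L[ℂ] H) : Prop :=
  ∀ (w : Set H) (e : HilbertBasis w ℂ H), Summable fun i => (inner ℂ (e i) (T (e i))).re

/-- The determinant of the compression of `1 + A` to the linear span `U` of a finite set of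
vectors, i.e. of the operator `1 + P A` on `U`, with `P` the orthogonal projection onto `U`. -/
noncomputable def compressionDet {H : Type*} [NormedAddCommGroup H] [InnerProductSpace ℂ H]
    (A : H →L[ℂ] H) (v : Finset H) : ℂ :=
  LinearMap.det (LinearMap.id +
    ((Submodule.span ℂ (v : Set H)).orthogonalProjectionOnto ∘L A ∘L
      (Submodule.span ℂ (v : Set H)).subtypeL :
        Submodule.span ℂ (v : Set H) →ₗ[ℂ] Submodule.span ℂ (v : Set H)))

/-- `d` is the Fredholm determinant `det (1 + A)`: the limit of the determinants of the
compressions of `1 + A` to finite dimensional subspaces, along the net of all these subspaces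
directed by inclusion. For every trace class operator `A` the limit exists, because
`P A P → A` in trace norm along this net and the determinant is continuous in trace norm. -/
def HasFredholmDet {H : Type*} [NormedAddCommGroup H] [InnerProductSpace ℂ H]
    (A : H →L[ℂ] H) (d : ℂ) : Prop :=
  Tendsto (compressionDet A) atTop (𝓝 d)

/-- The Fredholm determinant `det (1 + A)`. -/
noncomputable def fredholmDet {H : Type*} [NormedAddCommGroup H] [InnerProductSpace ℂ H]
    (A : H →L[ℂ] H) : ℂ :=
  limUnder atTop (compressionDet A)

section

variable {X : Type*} [MeasurableSpace X] {H₁ H₂ : Type*}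
  [NormedAddCommGroup H₁] [InnerProductSpace ℂ H₁] [CompleteSpace H₁]
  [NormedAddCommGroup H₂] [InnerProductSpace ℂ H₂] [CompleteSpace H₂]

/-- The conditions of the localization lemma on `W : H₂ → H₁`, for the statistics `s`
(`s = 1`: Bose, `s = -1`: Fermi): `tr W* F(X₀) W < ∞`, and in the Fermi case also `‖W‖ < 1`. -/
structure LocalizationCondition (F : POVM X H₁) (X₀ : Set X) (s : ℤ) (W : H₂ →L[ℂ] H₁) :
    Prop where
  finite_trace : HasFiniteTrace (ContinuousLinearMap.adjoint W ∘L F.toFun X₀ ∘L W)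
  norm_lt_one : s = -1 → ‖W‖ < 1

/-- The (real valued, measurable) test functions that vanish outside `X₀`. -/
def testFunctions (X₀ : Set X) : Set (X → ℝ) :=
  {f | Measurable f ∧ ∀ x, x ∉ X₀ → f x = 0}

/-- The operator `-s W* F[exp(i f) - 1] W`. -/
noncomputable def charOperator (F : POVM X H₁) (s : ℤ) (W : H₂ →L[ℂ] H₁) (f : X → ℝ) :
    H₂ →L[ℂ] H₂ :=
  (-(s : ℂ)) • (ContinuousLinearMap.adjoint W ∘L
    F.integral (fun x => Complex.exp (Complex.I * (f x : ℂ)) - 1) ∘L W)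

/-- The characteristic function `C(f) = det (1 - s W* F[exp(i f) - 1] W) ^ (-s)`. -/
noncomputable def charFunction (F : POVM X H₁) (s : ℤ) (W : H₂ →L[ℂ] H₁) (f : X → ℝ) : ℂ :=
  fredholmDet (charOperator F s W f) ^ (-s)

/-- The formula for `C(f)` makes sense for all test functions that vanish outside `X₀`: the
Fredholm determinant exists, and it is nonzero in the Bose case, where its inverse is taken. -/
def CharFunctionDefined (F : POVM X H₁) (X₀ : Set X) (s : ℤ) (W : H₂ →L[ℂ] H₁) : Prop :=
  ∀ f ∈ testFunctions X₀,
    HasFredholmDet (charOperator F s W f) (fredholmDet (charOperator F s W f)) ∧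
      (s = 1 → fredholmDet (charOperator F s W f) ≠ 0)

end

/-! Write `F(X₀) = S*S`. The trace condition says that `SW` is Hilbert-Schmidt. Since `|e^{if} - 1|
≤ 2` and `f` lives on `X₀`, the form of `F[e^{if} - 1]` is bounded by a constant times `‖Sφ‖ ‖Sψ‖`,
the same for all `f`. So only Hilbert-Schmidt norms relative to `S` matter.

The core is a perturbation bound for finite determinants `det(1 + ⟨φᵢ, Q ψⱼ⟩)`, independent of
dimension: they are bounded in terms of `∑‖Sφᵢ‖²` and `∑‖Sψⱼ‖²`, and are polynomial along a complex
line of families, so the Schwarz lemma turns the bound into a Lipschitz estimate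
(`norm_det_formMatrix_sub_le`). Applied to `W` against `WP`, `P` a finite rank projection, it makes
the compressions a Cauchy net; applied to `W_α` against `W_∞`, it gives uniform convergence.

The order relation means `‖W_α*ψ‖ ≤ ‖W₀*ψ‖`, so dominated convergence over a basis of `H₁` upgrades
strong convergence of `W_α*` to Hilbert-Schmidt convergence of `W_α*S*`. For `s = 1` the operator
inside the determinant has nonnegative real part, so the determinant has modulus at least 1 and can
be inverted. -/

namespace Matrix

/-! ### Bounds for finite determinants -/

variable {n : Type*} [Fintype n] [DecidableEq n]

theorem normSq_det_eq_prod_eigenvalues (N : Matrix n n ℂ) :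
    ‖N.det‖ ^ 2 = ∏ i, (isHermitian_conjTranspose_mul_self N).eigenvalues i := by
  have h := (isHermitian_conjTranspose_mul_self N).det_eq_prod_eigenvalues
  rw [det_mul, det_conjTranspose] at h
  have h2 : star N.det * N.det = ((‖N.det‖ ^ 2 : ℝ) : ℂ) := by
    simpa using Complex.conj_mul' N.det
  rw [h2] at h
  exact Complex.ofReal_injective (h.trans (by push_cast; rfl))

/-- With `λᵢ` the eigenvalues of `N*N`, `N = 1 + M`, the inequality `λ ≤ exp(λ - 1)` gives `|det N|²
≤ exp(tr(N*N - 1))`, and this trace is twice the exponent. -/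
theorem norm_det_one_add_le (M : Matrix n n ℂ) :
    ‖(1 + M).det‖ ≤ Real.exp (M.trace.re + (∑ i, ∑ j, ‖M i j‖ ^ 2) / 2) := by
  set N := 1 + M with hN
  have hH := isHermitian_conjTranspose_mul_self N
  have htr : ∑ i, (hH.eigenvalues i - 1) = 2 * M.trace.re + ∑ i, ∑ j, ‖M i j‖ ^ 2 := by
    have h1 := hH.trace_eq_sum_eigenvalues
    have h2 : (Nᴴ * N).trace = (Fintype.card n : ℂ) + M.trace + star M.trace
        + ((∑ i, ∑ j, ‖M i j‖ ^ 2 : ℝ) : ℂ) := by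
      have h3 : (Mᴴ * M).trace = ((∑ i, ∑ j, ‖M i j‖ ^ 2 : ℝ) : ℂ) := by
        simp only [trace, diag_apply, mul_apply, conjTranspose_apply]
        rw [Finset.sum_comm]
        push_cast
        refine Finset.sum_congr rfl fun i _ => Finset.sum_congr rfl fun j _ => ?_
        simpa using Complex.conj_mul' (M i j)
      rw [hN, conjTranspose_add, conjTranspose_one, add_mul, mul_add, mul_add, one_mul, one_mul,
        mul_one, trace_add, trace_add, trace_add, trace_one, trace_conjTranspose, h3]
      ring
    rw [h2] at h1
    have h4 := congrArg Complex.re h1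
    simp only [Complex.add_re, Complex.natCast_re, Complex.ofReal_re, Complex.re_sum,
      Complex.star_def, Complex.conj_re, Complex.coe_algebraMap] at h4
    rw [Finset.sum_sub_distrib, Finset.sum_const, Finset.card_univ, nsmul_eq_mul, mul_one]
    have h5 : ∑ x, ((hH.eigenvalues x : ℂ)).re = ∑ x, hH.eigenvalues x := by simp
    have h6 : (∑ x, ((hH.eigenvalues x : ℂ)).re)
      = Fintype.card n + M.trace.re + M.trace.re + ∑ i, ∑ j, ‖M i j‖ ^ 2 := h4.symm
    linarith
  have hsq : ‖N.det‖ ^ 2 ≤ Real.exp (M.trace.re + (∑ i, ∑ j, ‖M i j‖ ^ 2) / 2) ^ 2 := by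
    rw [normSq_det_eq_prod_eigenvalues, ← Real.exp_nat_mul]
    calc ∏ i, hH.eigenvalues i ≤ ∏ i, Real.exp (hH.eigenvalues i - 1) :=
          Finset.prod_le_prod
            (fun i _ => (posSemidef_conjTranspose_mul_self N).eigenvalues_nonneg i)
            (fun i _ => by linarith [Real.add_one_le_exp (hH.eigenvalues i - 1)])
      _ = _ := by
        rw [← Real.exp_sum, htr]
        congr 1
        push_cast
        ring
  exact (sq_le_sq₀ (norm_nonneg _) (Real.exp_pos _).le).mp hsq

/-- `N*N = 1 + (M + M*) + M*M ≥ 1`, so every eigenvalue of `N*N` is at least 1. -/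
theorem one_le_norm_det_one_add (M : Matrix n n ℂ) (hM : ∀ x : n → ℂ, 0 ≤ (star x ⬝ᵥ M *ᵥ x).re) :
    1 ≤ ‖(1 + M).det‖ := by
  set N := 1 + M with hN
  have hH := isHermitian_conjTranspose_mul_self N
  have h1 : ∀ i, 1 ≤ hH.eigenvalues i := by
    intro i
    rw [hH.eigenvalues_eq]
    set v : n → ℂ := ⇑(hH.eigenvectorBasis i) with hv
    have hvv : (star v ⬝ᵥ v) = 1 := by
      have h := (hH.eigenvectorBasis.orthonormal.1 i)
      have h2 := inner_self_eq_norm_sq_to_K (𝕜 := ℂ) (hH.eigenvectorBasis i)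
      rw [h, EuclideanSpace.inner_eq_star_dotProduct, dotProduct_comm] at h2
      simpa using h2
    have e : star v ⬝ᵥ (Nᴴ * N) *ᵥ v = star v ⬝ᵥ v + star v ⬝ᵥ M *ᵥ v
        + star (star v ⬝ᵥ M *ᵥ v) + star (M *ᵥ v) ⬝ᵥ (M *ᵥ v) := by
      rw [← mulVec_mulVec, dotProduct_mulVec, ← star_mulVec, hN, add_mulVec, one_mulVec, star_add,
        add_dotProduct, dotProduct_add, dotProduct_add]
      rw [dotProduct_comm, ← star_dotProduct_star, star_star, dotProduct_comm]
      ring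
    rw [e, hvv]
    have h3 : 0 ≤ (star (M *ᵥ v) ⬝ᵥ (M *ᵥ v)).re :=
      (Complex.nonneg_iff.mp (dotProduct_star_self_nonneg (M *ᵥ v))).1
    have h4 := hM v
    simp only [RCLike.re_to_complex, Complex.add_re, Complex.star_def, Complex.conj_re,
      Complex.one_re]
    linarith
  have h2 : (1 : ℝ) ≤ ‖N.det‖ ^ 2 := by
    rw [normSq_det_eq_prod_eigenvalues]
    calc (1 : ℝ) = ∏ _i : n, (1 : ℝ) := by simp
      _ ≤ _ := Finset.prod_le_prod (fun _ _ => zero_le_one) fun i _ => h1 i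
  nlinarith [norm_nonneg N.det]

/-- Factorized entry bounds control both the trace and the Hilbert-Schmidt norm by `κΓ`, whatever
the size of the matrix. -/
theorem norm_det_one_add_le_of_entry_le (M : Matrix n n ℂ) {κ Γ : ℝ} (hκ : 0 ≤ κ) (a b : n → ℝ)
    (hM : ∀ i j, ‖M i j‖ ≤ κ * a i * b j) (ha : ∑ i, a i ^ 2 ≤ Γ) (hb : ∑ i, b i ^ 2 ≤ Γ) :
    ‖(1 + M).det‖ ≤ Real.exp (κ * Γ + (κ * Γ) ^ 2 / 2) := by
  have hΓ : 0 ≤ Γ := (Finset.sum_nonneg fun i _ => sq_nonneg (a i)).trans ha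
  refine (norm_det_one_add_le M).trans (Real.exp_le_exp.mpr (add_le_add ?_ ?_))
  · calc M.trace.re = ∑ i, (M i i).re := by simp [trace]
      _ ≤ ∑ i, κ * ((a i ^ 2 + b i ^ 2) / 2) := by
        refine Finset.sum_le_sum fun i _ => (Complex.re_le_norm _).trans ((hM i i).trans ?_)
        rw [mul_assoc]
        exact mul_le_mul_of_nonneg_left (by nlinarith [sq_nonneg (a i - b i)]) hκ
      _ = κ * ((∑ i, a i ^ 2 + ∑ i, b i ^ 2) / 2) := by
        rw [← Finset.mul_sum, ← Finset.sum_div, Finset.sum_add_distrib]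
      _ ≤ κ * Γ := mul_le_mul_of_nonneg_left (by linarith) hκ
  · refine div_le_div_of_nonneg_right ?_ zero_le_two
    calc ∑ i, ∑ j, ‖M i j‖ ^ 2 ≤ ∑ i, ∑ j, κ ^ 2 * (a i ^ 2 * b j ^ 2) := by
          refine Finset.sum_le_sum fun i _ => Finset.sum_le_sum fun j _ => ?_
          calc ‖M i j‖ ^ 2 ≤ (κ * a i * b j) ^ 2 := pow_le_pow_left₀ (norm_nonneg _) (hM i j) 2
            _ = _ := by ring
      _ = κ ^ 2 * ((∑ i, a i ^ 2) * ∑ i, b i ^ 2) := by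
        rw [Finset.sum_mul_sum, Finset.mul_sum]
        simp only [Finset.mul_sum]
      _ ≤ κ ^ 2 * (Γ * Γ) := by
        refine mul_le_mul_of_nonneg_left (mul_le_mul ha hb ?_ hΓ) (sq_nonneg κ)
        exact Finset.sum_nonneg fun i _ => sq_nonneg (b i)
      _ = (κ * Γ) ^ 2 := by ring

end Matrix

/-! ### Lipschitz dependence of determinants on vector families -/

section

variable {n : Type*} [Fintype n] {H K : Type*}
  [NormedAddCommGroup H] [InnerProductSpace ℂ H] [NormedAddCommGroup K] [NormedSpace ℂ K]

/-- The matrix of the sesquilinear form of `Q` between two families of vectors. -/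
noncomputable def formMatrix (Q : H →L[ℂ] H) (φ ψ : n → H) : Matrix n n ℂ :=
  Matrix.of fun i j => inner ℂ (φ i) (Q (ψ j))

/-- Keeps the families bounded on the whole disc `|z| ≤ 1/δ`, by `‖a + b‖² ≤ 2‖a‖² + 2‖b‖²`. -/
theorem sum_sq_norm_add_smul_le (S : H →L[ℂ] K) (φ χ : n → H) {z : ℂ} {β δ : ℝ}
    (hβ : ∑ i, ‖S (φ i)‖ ^ 2 ≤ β) (hδ : ∑ i, ‖S (χ i)‖ ^ 2 ≤ δ ^ 2) (hz : ‖z‖ * δ ≤ 1)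
    (hδ0 : 0 ≤ δ) : ∑ i, ‖S (φ i + z • χ i)‖ ^ 2 ≤ 2 * β + 2 := by
  have h : ∀ i, ‖S (φ i + z • χ i)‖ ^ 2 ≤ 2 * ‖S (φ i)‖ ^ 2 + 2 * ‖z‖ ^ 2 * ‖S (χ i)‖ ^ 2 := by
    intro i
    rw [map_add, map_smul]
    have h1 := norm_add_le (S (φ i)) (z • S (χ i))
    rw [norm_smul] at h1
    have h2 := pow_le_pow_left₀ (norm_nonneg _) h1 2
    nlinarith [sq_nonneg (‖S (φ i)‖ - ‖z‖ * ‖S (χ i)‖)]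
  calc _ ≤ ∑ i, (2 * ‖S (φ i)‖ ^ 2 + 2 * ‖z‖ ^ 2 * ‖S (χ i)‖ ^ 2) := Finset.sum_le_sum fun i _ => h i
    _ = 2 * ∑ i, ‖S (φ i)‖ ^ 2 + 2 * ‖z‖ ^ 2 * ∑ i, ‖S (χ i)‖ ^ 2 := by
      rw [Finset.sum_add_distrib, Finset.mul_sum, Finset.mul_sum]
    _ ≤ 2 * β + 2 * ‖z‖ ^ 2 * δ ^ 2 := by gcongr
    _ ≤ 2 * β + 2 := by
      have : (‖z‖ * δ) ^ 2 ≤ 1 := pow_le_one₀ (by positivity) hz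
      nlinarith

/-- The determinant `det (1 + ⟨φ i, Q ψ j⟩)` depends in a Lipschitz way on the families `φ`, `ψ`,
uniformly in their size, if the form `Q` is bounded with respect to the seminorm `‖S ·‖`. -/
theorem norm_det_formMatrix_sub_le [DecidableEq n] (S : H →L[ℂ] K) (Q : H →L[ℂ] H) {κ β δ : ℝ}
    (hκ : 0 ≤ κ) (hQ : ∀ φ ψ, ‖inner ℂ φ (Q ψ)‖ ≤ κ * ‖S φ‖ * ‖S ψ‖) (φ φ' ψ ψ' : n → H)
    (hδ0 : 0 < δ) (hδ1 : δ < 1)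
    (hφ : ∑ i, ‖S (φ i)‖ ^ 2 ≤ β) (hψ : ∑ i, ‖S (ψ i)‖ ^ 2 ≤ β)
    (hφ' : ∑ i, ‖S (φ' i - φ i)‖ ^ 2 ≤ δ ^ 2) (hψ' : ∑ i, ‖S (ψ' i - ψ i)‖ ^ 2 ≤ δ ^ 2) :
    ‖(1 + formMatrix Q φ' ψ').det - (1 + formMatrix Q φ ψ).det‖ ≤
      2 * Real.exp (κ * (2 * β + 2) + (κ * (2 * β + 2)) ^ 2 / 2) * δ := by
  set C := Real.exp (κ * (2 * β + 2) + (κ * (2 * β + 2)) ^ 2 / 2) with hC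
  -- The conjugate compensates for the conjugate linear first slot, so `h` is a polynomial in `z`,
  -- joining the two determinants at `z = 0` and `z = 1`.
  let h : ℂ → ℂ := fun z => (1 + formMatrix Q (fun i => φ i + (starRingEnd ℂ) z • (φ' i - φ i))
    (fun j => ψ j + z • (ψ' j - ψ j))).det
  have hb : ∀ z ∈ Metric.ball (0 : ℂ) (1 / δ), ‖h z‖ ≤ C := by
    intro z hz
    have hz' : ‖z‖ * δ ≤ 1 := by
      rw [mem_ball_zero_iff, lt_div_iff₀ hδ0] at hz
      exact hz.le
    refine Matrix.norm_det_one_add_le_of_entry_le _ hκ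
      (fun i => ‖S (φ i + (starRingEnd ℂ) z • (φ' i - φ i))‖)
      (fun j => ‖S (ψ j + z • (ψ' j - ψ j))‖) (fun i j => hQ _ _) ?_ ?_
    · exact sum_sq_norm_add_smul_le S φ _ hφ hφ' (by simpa using hz') hδ0.le
    · exact sum_sq_norm_add_smul_le S ψ _ hψ hψ' hz' hδ0.le
  have hd : Differentiable ℂ h := by
    have hentry : ∀ i j, Differentiable ℂ fun z : ℂ =>
        (1 + formMatrix Q (fun i => φ i + (starRingEnd ℂ) z • (φ' i - φ i))
          (fun j => ψ j + z • (ψ' j - ψ j))) i j := by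
      intro i j
      simp only [Matrix.add_apply, formMatrix, Matrix.of_apply, inner_add_left, inner_smul_left,
        Complex.conj_conj, map_add, map_smul, inner_add_right, inner_smul_right]
      fun_prop
    simp only [h, Matrix.det_apply]
    refine Differentiable.fun_sum fun σ _ => Differentiable.const_smul ?_ _
    exact Differentiable.fun_finsetProd fun i _ => hentry _ _
  have h0 : h 0 = (1 + formMatrix Q φ ψ).det := by simp [h]
  have h1 : h 1 = (1 + formMatrix Q φ' ψ').det := by simp [h]
  have h0m : (0 : ℂ) ∈ Metric.ball (0 : ℂ) (1 / δ) := Metric.mem_ball_self (by positivity)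
  -- Schwarz lemma: `h - h 0` is at most `2C` on the disc of radius `1/δ`, hence at most `2Cδ` at `z
  -- = 1`, which lies in the disc because `δ < 1`.
  have key := Complex.dist_le_div_mul_dist_of_mapsTo_ball (f := h) (c := 0) (z := 1)
    (R₁ := 1 / δ) (R₂ := 2 * C) hd.differentiableOn
    (fun z hz => by
      rw [Metric.mem_closedBall, dist_eq_norm]
      linarith [norm_sub_le (h z) (h 0), hb z hz, hb 0 h0m])
    (by rw [mem_ball_zero_iff, norm_one]; exact (one_lt_div hδ0).mpr hδ1)
  rw [h0, h1, dist_eq_norm] at key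
  simpa using key

end

/-! ### Hilbert-Schmidt sums -/

theorem HilbertBasis.hasSum_sq_norm_inner {κ K : Type*} [NormedAddCommGroup K]
    [InnerProductSpace ℂ K] (e : HilbertBasis κ ℂ K) (x : K) :
    HasSum (fun k => ‖inner ℂ (e k) x‖ ^ 2) (‖x‖ ^ 2) := by
  have h := Complex.hasSum_re (e.hasSum_inner_mul_inner x x)
  have h2 : (inner ℂ x x : ℂ).re = ‖x‖ ^ 2 := inner_self_eq_norm_sq (𝕜 := ℂ) x
  rw [h2] at h
  convert h using 1
  ext k
  rw [← inner_conj_symm x (e k), Complex.conj_mul']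
  exact (Complex.ofReal_re _).symm.trans (by push_cast; rfl)

section

local postfix:max "†" => ContinuousLinearMap.adjoint

variable {H K : Type*} [NormedAddCommGroup H] [InnerProductSpace ℂ H] [CompleteSpace H]
  [NormedAddCommGroup K] [InnerProductSpace ℂ K] [CompleteSpace K]

/-- The Hilbert-Schmidt norm of the adjoint, computed in a Hilbert basis, bounds the sum over any
orthonormal family. -/
theorem Orthonormal.sum_sq_norm_apply_le {κ n : Type*} (e : HilbertBasis κ ℂ K) (B : H →L[ℂ] K)
    (hB : Summable fun k => ‖B† (e k)‖ ^ 2) {b : n → H}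
    (hb : Orthonormal ℂ b) (t : Finset n) :
    ∑ i ∈ t, ‖B (b i)‖ ^ 2 ≤ ∑' k, ‖B† (e k)‖ ^ 2 := by
  -- Parseval in `e` for each `B (b i)`, exchange of the sums, then Bessel for each `B† (e k)`.
  refine hasSum_le (fun k => ?_)
    (hasSum_sum fun i _ => e.hasSum_sq_norm_inner (B (b i))) hB.hasSum
  refine le_trans (le_of_eq ?_) (hb.sum_inner_products_le (B† (e k)) (s := t))
  refine Finset.sum_congr rfl fun i _ => ?_
  rw [← ContinuousLinearMap.adjoint_inner_left, norm_inner_symm]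

theorem summable_sq_norm_apply_of_adjoint {κ : Type*} {w : Type*} (e : HilbertBasis κ ℂ K)
    (B : H →L[ℂ] K) (hB : Summable fun k => ‖B† (e k)‖ ^ 2)
    {b : w → H} (hb : Orthonormal ℂ b) : Summable fun i => ‖B (b i)‖ ^ 2 :=
  summable_of_sum_le (fun _ => sq_nonneg _) (hb.sum_sq_norm_apply_le e B hB)

end

/-! ### Compressions to finite dimensional subspaces -/

section

variable {H : Type*} [NormedAddCommGroup H] [InnerProductSpace ℂ H]

/-- Dominated convergence: the `k`-th term vanishes as soon as `x k ∈ v`, and `‖x k‖²` is a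
majorant. -/
theorem tendsto_tsum_sq_norm_sub_starProjection {κ : Type*} (x : κ → H) (hx : Summable fun k => ‖x k‖ ^ 2) :
    Tendsto (fun v : Finset H =>
      ∑' k, ‖x k - (Submodule.span ℂ (v : Set H)).starProjection (x k)‖ ^ 2) atTop (𝓝 0) := by
  have h := tendsto_tsum_of_dominated_convergence (𝓕 := (atTop : Filter (Finset H)))
    (f := fun v k => ‖x k - (Submodule.span ℂ (v : Set H)).starProjection (x k)‖ ^ 2)
    (g := fun _ => (0 : ℝ)) hx ?_ ?_
  · simpa using h
  · intro k
    refine tendsto_const_nhds.congr' ?_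
    filter_upwards [eventually_ge_atTop {x k}] with v hv
    have hmem : x k ∈ Submodule.span ℂ (v : Set H) :=
      Submodule.subset_span (by simpa using hv)
    rw [Submodule.starProjection_eq_self_iff.mpr hmem]
    simp
  · refine Eventually.of_forall fun v k => ?_
    rw [Real.norm_of_nonneg (by positivity)]
    refine pow_le_pow_left₀ (norm_nonneg _) ?_ 2
    rw [← Submodule.starProjection_orthogonal_val]
    exact Submodule.norm_starProjection_apply_le _ _

theorem compressionDet_eq_det {m : Type*} [Fintype m] [DecidableEq m] (A : H →L[ℂ] H)
    (v : Finset H) (b : OrthonormalBasis m ℂ (Submodule.span ℂ (v : Set H))) :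
    compressionDet A v = (1 + formMatrix A (fun i => (b i : H)) (fun i => (b i : H))).det := by
  rw [compressionDet, ← LinearMap.det_toMatrix b.toBasis, map_add, LinearMap.toMatrix_id]
  congr 2
  ext i j
  rw [LinearMap.toMatrix_apply]
  simp only [OrthonormalBasis.coe_toBasis, OrthonormalBasis.coe_toBasis_repr_apply,
    OrthonormalBasis.repr_apply_apply, formMatrix, Matrix.of_apply]
  exact Submodule.inner_orthogonalProjectionOnto_eq_of_mem_left (b i) (A (b j))

/-- The determinant of a compression to a subspace, computed in a larger subspace. -/
theorem compressionDet_eq_det_of_subset {m : Type*} [Fintype m] [DecidableEq m] (A : H →L[ℂ] H)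
    {v v' : Finset H} (hv : v ⊆ v') (b' : OrthonormalBasis m ℂ (Submodule.span ℂ (v' : Set H))) :
    compressionDet A v = (1 + formMatrix A (fun i => (b' i : H))
      (fun j => (Submodule.span ℂ (v : Set H)).starProjection (b' j : H))).det := by
  let U := Submodule.span ℂ (v : Set H)
  let U' := Submodule.span ℂ (v' : Set H)
  have hU : U ≤ U' := Submodule.span_mono (by exact_mod_cast hv)
  let b := stdOrthonormalBasis ℂ U
  rw [compressionDet_eq_det A v b]
  -- The compression to the smaller span factors as `Y * X` through the larger one; the determinant
  -- of `1 + Y * X` equals that of `1 + X * Y`.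
  let X : Matrix m (Fin (Module.finrank ℂ U)) ℂ :=
    Matrix.of fun k j => inner ℂ (b' k : H) (A (b j))
  let Y : Matrix (Fin (Module.finrank ℂ U)) m ℂ :=
    Matrix.of fun i k => inner ℂ (b i : H) (b' k : H)
  have h1 : formMatrix A (fun i => (b i : H)) (fun i => (b i : H)) = Y * X := by
    ext i j
    simp only [Matrix.mul_apply, X, Y, Matrix.of_apply, formMatrix]
    have h := b'.sum_inner_mul_inner ⟨b i, hU (b i).2⟩ (U'.orthogonalProjectionOnto (A (b j)))
    simp only [Submodule.coe_inner] at h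
    have h3 : ∀ u : U', inner ℂ (u : H) ((U'.orthogonalProjectionOnto (A (b j)) : U') : H)
        = inner ℂ (u : H) (A (b j)) := fun u =>
      Submodule.inner_orthogonalProjectionOnto_eq_of_mem_left u (A (b j))
    rw [h3 ⟨b i, hU (b i).2⟩] at h
    simp only [h3] at h
    exact h.symm
  have h2 : formMatrix A (fun i => (b' i : H)) (fun j => U.starProjection (b' j : H)) = X * Y := by
    ext k l
    simp only [Matrix.mul_apply, X, Y, Matrix.of_apply, formMatrix]
    have h : U.starProjection (b' l : H) = ∑ i, inner ℂ (b i : H) (b' l : H) • (b i : H) := by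
      have h4 := congrArg (Submodule.subtype U)
        (b.sum_repr' (U.orthogonalProjectionOnto (b' l : H))).symm
      rw [map_sum] at h4
      simp only [map_smul, Submodule.subtype_apply, Submodule.coe_inner] at h4
      rw [Submodule.starProjection_apply, h4]
      refine Finset.sum_congr rfl fun i _ => ?_
      congr 1
      exact Submodule.inner_orthogonalProjectionOnto_eq_of_mem_left (b i) _
    rw [h, map_sum, inner_sum]
    refine Finset.sum_congr rfl fun i _ => ?_
    rw [map_smul, inner_smul_right, mul_comm]
  exact (congrArg (fun M => (1 + M).det) h1).trans ((Matrix.det_one_add_mul_comm _ _).trans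
    (congrArg (fun M => (1 + M).det) h2).symm)

theorem one_le_norm_compressionDet (A : H →L[ℂ] H) (hA : ∀ x, 0 ≤ (inner ℂ x (A x)).re)
    (v : Finset H) : 1 ≤ ‖compressionDet A v‖ := by
  let b := stdOrthonormalBasis ℂ (Submodule.span ℂ (v : Set H))
  rw [compressionDet_eq_det A v b]
  refine Matrix.one_le_norm_det_one_add _ fun x => ?_
  convert hA (∑ i, x i • (b i : H)) using 2
  simp only [map_sum, sum_inner, inner_sum, map_smul, inner_smul_left, inner_smul_right,
    dotProduct, Matrix.mulVec, formMatrix, Matrix.of_apply, Finset.mul_sum, Pi.star_apply,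
    Complex.star_def]
  rw [Finset.sum_comm]
  exact Finset.sum_congr rfl fun i _ => Finset.sum_congr rfl fun j _ => by ring

end

/-! ### Existence and continuity of the Fredholm determinant -/

section

variable {H₁ H₂ : Type*} [NormedAddCommGroup H₁] [InnerProductSpace ℂ H₁] [CompleteSpace H₁]
  [NormedAddCommGroup H₂] [InnerProductSpace ℂ H₂] [CompleteSpace H₂]

local postfix:max "†" => ContinuousLinearMap.adjoint

theorem formMatrix_adjoint_comp {n : Type*} (W : H₂ →L[ℂ] H₁) (Q : H₁ →L[ℂ] H₁) (φ ψ : n → H₂) :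
    formMatrix (W† ∘L Q ∘L W) φ ψ = formMatrix Q (fun i => W (φ i)) (fun i => W (ψ i)) := by
  ext i j
  simp [formMatrix, ContinuousLinearMap.adjoint_inner_right]

variable {κ : Type*} (e : HilbertBasis κ ℂ H₁)

/-- The bound does not depend on `v`, so it survives the passage to the Fredholm determinants. The
hypotheses are on the adjoint side, where strong convergence of `W_α*` is usable. -/
theorem norm_compressionDet_sub_le {S Q : H₁ →L[ℂ] H₁} {c β δ : ℝ} (hc : 0 ≤ c)
    (hQ : ∀ φ ψ, ‖inner ℂ φ (Q ψ)‖ ≤ c * ‖S φ‖ * ‖S ψ‖) {W W' : H₂ →L[ℂ] H₁}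
    (hW : Summable fun k => ‖W† (S† (e k))‖ ^ 2)
    (hβ : ∑' k, ‖W† (S† (e k))‖ ^ 2 ≤ β)
    (hW' : Summable fun k => ‖W'† (S† (e k)) - W† (S† (e k))‖ ^ 2)
    (hδ0 : 0 < δ) (hδ1 : δ < 1)
    (hδ : ∑' k, ‖W'† (S† (e k)) - W† (S† (e k))‖ ^ 2 ≤ δ ^ 2) (v : Finset H₂) :
    ‖compressionDet (W'† ∘L Q ∘L W') v - compressionDet (W† ∘L Q ∘L W) v‖ ≤
      2 * Real.exp (c * (2 * β + 2) + (c * (2 * β + 2)) ^ 2 / 2) * δ := by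
  let b := stdOrthonormalBasis ℂ (Submodule.span ℂ (v : Set H₂))
  have hb : Orthonormal ℂ fun i => (b i : H₂) :=
    b.orthonormal.comp_linearIsometry (Submodule.subtypeₗᵢ _)
  rw [compressionDet_eq_det _ v b, compressionDet_eq_det _ v b, formMatrix_adjoint_comp,
    formMatrix_adjoint_comp]
  have h1 : ∑ i, ‖S (W (b i))‖ ^ 2 ≤ β := by
    refine le_trans (hb.sum_sq_norm_apply_le e (S ∘L W) ?_ Finset.univ) ?_ <;>
      simpa [ContinuousLinearMap.adjoint_comp]
  have h2 : ∑ i, ‖S (W' (b i) - W (b i))‖ ^ 2 ≤ δ ^ 2 := by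
    refine le_trans (hb.sum_sq_norm_apply_le e (S ∘L (W' - W)) ?_ Finset.univ) ?_ <;>
      simpa [ContinuousLinearMap.adjoint_comp]
  exact norm_det_formMatrix_sub_le S Q hc hQ _ _ _ _ hδ0 hδ1 h1 h1 h2 h2

/-- The Fredholm determinant of `1 + W* Q W` exists if `Q` is bounded with respect to the seminorm
`‖S ·‖` and `S W` is a Hilbert-Schmidt operator. -/
theorem hasFredholmDet_fredholmDet {S Q : H₁ →L[ℂ] H₁} {c : ℝ} (hc : 0 ≤ c)
    (hQ : ∀ φ ψ, ‖inner ℂ φ (Q ψ)‖ ≤ c * ‖S φ‖ * ‖S ψ‖) {W : H₂ →L[ℂ] H₁}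
    (hW : Summable fun k => ‖W† (S† (e k))‖ ^ 2) :
    HasFredholmDet (W† ∘L Q ∘L W) (fredholmDet (W† ∘L Q ∘L W)) := by
  classical
  refine CauchySeq.tendsto_limUnder (Metric.cauchySeq_iff'.mpr fun ε hε => ?_)
  set β := ∑' k, ‖W† (S† (e k))‖ ^ 2
  set C := 2 * Real.exp (c * (2 * β + 2) + (c * (2 * β + 2)) ^ 2 / 2)
  have hC : 0 < C := by positivity
  obtain ⟨δ, hδ0, hδ⟩ := exists_between (show 0 < min 1 (ε / C) by positivity)
  obtain ⟨hδ1, hδε⟩ := lt_min_iff.mp hδ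
  -- Choose `v` so that `P W*S*` is close to `W*S*` in Hilbert-Schmidt norm, `P` being the
  -- projection onto the span of `v`.
  obtain ⟨v, hv⟩ := ((tendsto_tsum_sq_norm_sub_starProjection _ hW).eventually
    (eventually_lt_nhds (show 0 < δ ^ 2 by positivity))).exists
  refine ⟨v, fun v' hv' => ?_⟩
  set P := (Submodule.span ℂ (v : Set H₂)).starProjection with hP
  have hPad : P† = P := (isSelfAdjoint_starProjection _).adjoint_eq
  let b := stdOrthonormalBasis ℂ (Submodule.span ℂ (v' : Set H₂))
  have hb : Orthonormal ℂ fun i => (b i : H₂) :=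
    b.orthonormal.comp_linearIsometry (Submodule.subtypeₗᵢ _)
  have h1 : ∑ i, ‖S (W (b i))‖ ^ 2 ≤ β := by
    refine le_trans (hb.sum_sq_norm_apply_le e (S ∘L W) ?_ Finset.univ) ?_
    · simpa [ContinuousLinearMap.adjoint_comp]
    · simp [ContinuousLinearMap.adjoint_comp, β]
  have h2 : ∑ i, ‖S (W (P (b i)) - W (b i))‖ ^ 2 ≤ δ ^ 2 := by
    have hs : Summable fun k => ‖W† (S† (e k)) - P (W† (S† (e k)))‖ ^ 2 := by
      refine hW.of_nonneg_of_le (fun _ => sq_nonneg _) fun k => ?_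
      refine pow_le_pow_left₀ (norm_nonneg _) ?_ 2
      rw [hP, ← Submodule.starProjection_orthogonal_val]
      exact Submodule.norm_starProjection_apply_le _ _
    have hadj : ∀ k, ‖(S ∘L W ∘L (P - 1))† (e k)‖ ^ 2
        = ‖W† (S† (e k)) - P (W† (S† (e k)))‖ ^ 2 := by
      intro k
      rw [norm_sub_rev]
      simp [ContinuousLinearMap.adjoint_comp, hPad, ContinuousLinearMap.one_def]
    have h3 := hb.sum_sq_norm_apply_le e (S ∘L W ∘L (P - 1)) (by simpa only [hadj]) Finset.univ
    simp only [hadj] at h3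
    refine le_trans (le_of_eq ?_) (h3.trans hv.le)
    simp
  rw [dist_comm, dist_eq_norm, compressionDet_eq_det _ v' b, compressionDet_eq_det_of_subset _ hv' b,
    formMatrix_adjoint_comp, formMatrix_adjoint_comp]
  -- Only the second family moves, from `W bᵢ` to `W P bᵢ`; the difference of the first families is
  -- zero.
  refine (norm_det_formMatrix_sub_le S Q hc hQ _ _ _ _ hδ0 hδ1 h1 h1 ?_ h2).trans_lt ?_
  · simp; positivity
  · calc C * δ < C * (ε / C) := by gcongr
      _ = ε := by field_simp

end

/-! ### Lower bound for the determinant and bounds for forms -/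

section

variable {H : Type*} [NormedAddCommGroup H] [InnerProductSpace ℂ H]

/-- Mere nonvanishing of the compressions could be lost in the limit; the uniform lower bound is
not. -/
theorem one_le_norm_fredholmDet {A : H →L[ℂ] H} (hA : ∀ x, 0 ≤ (inner ℂ x (A x)).re)
    (hd : HasFredholmDet A (fredholmDet A)) : 1 ≤ ‖fredholmDet A‖ :=
  ge_of_tendsto hd.norm (Eventually.of_forall fun v => one_le_norm_compressionDet A hA v)

/-- If `‖Sφ‖, ‖Sψ‖ ≤ 1`, each of the four polarization terms is at most `4c`, and so is their sum
divided by 4. The rest is scaling. -/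
theorem norm_inner_apply_le_of_norm_inner_apply_self_le {K : Type*} [NormedAddCommGroup K]
    [NormedSpace ℂ K] (S : H →L[ℂ] K) (T : H →L[ℂ] H) {c : ℝ}
    (hT : ∀ ψ, ‖inner ℂ ψ (T ψ)‖ ≤ c * ‖S ψ‖ ^ 2) (hc : 0 ≤ c) (φ ψ : H) :
    ‖inner ℂ φ (T ψ)‖ ≤ 4 * c * ‖S φ‖ * ‖S ψ‖ := by
  have h1 : ∀ φ ψ : H, ‖S φ‖ ≤ 1 → ‖S ψ‖ ≤ 1 → ‖inner ℂ φ (T ψ)‖ ≤ 4 * c := by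
    intro φ ψ hφ hψ
    have key : ∀ χ : H, ‖S χ‖ ≤ 2 → ‖inner ℂ (T χ) χ‖ ≤ 4 * c := by
      intro χ hχ
      rw [norm_inner_symm]
      refine (hT χ).trans ?_
      nlinarith [pow_le_pow_left₀ (norm_nonneg _) hχ 2]
    have k1 := key (φ + ψ) (by rw [map_add]; linarith [norm_add_le (S φ) (S ψ)])
    have k2 := key (φ - ψ) (by rw [map_sub]; linarith [norm_sub_le (S φ) (S ψ)])
    have k3 := key (φ + Complex.I • ψ) (by
      have h := norm_add_le (S φ) (Complex.I • S ψ)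
      rw [norm_smul, Complex.norm_I] at h
      rw [map_add, map_smul]; linarith)
    have k4 := key (φ - Complex.I • ψ) (by
      have h := norm_sub_le (S φ) (Complex.I • S ψ)
      rw [norm_smul, Complex.norm_I] at h
      rw [map_sub, map_smul]; linarith)
    have hp := inner_map_polarization (T : H →ₗ[ℂ] H) φ ψ
    simp only [ContinuousLinearMap.coe_coe] at hp
    rw [norm_inner_symm, hp, norm_div, div_le_iff₀ (by norm_num)]
    refine (norm_sub_le _ _).trans ?_
    refine (add_le_add_left (norm_add_le _ _) _).trans ?_
    refine (add_le_add_left (add_le_add_left (norm_sub_le _ _) _) _).trans ?_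
    simp only [norm_mul, Complex.norm_I, one_mul, Complex.norm_ofNat]
    linarith
  -- The shift by `ε` allows normalization of vectors on which `S` vanishes; then `ε → 0`.
  have h2 : ∀ ε : ℝ, 0 < ε → ‖inner ℂ φ (T ψ)‖ ≤ 4 * c * (‖S φ‖ + ε) * (‖S ψ‖ + ε) := by
    intro ε hε
    have hscale : ∀ χ : H, ‖S ((((‖S χ‖ + ε)⁻¹ : ℝ) : ℂ) • χ)‖ ≤ 1 := by
      intro χ
      have hpos : 0 < ‖S χ‖ + ε := by positivity
      rw [map_smul, norm_smul, Complex.norm_real, Real.norm_of_nonneg (by positivity),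
        inv_mul_le_iff₀ hpos]
      linarith
    have h := h1 _ _ (hscale φ) (hscale ψ)
    have hφ : 0 < ‖S φ‖ + ε := by positivity
    have hψ : 0 < ‖S ψ‖ + ε := by positivity
    rw [map_smul, inner_smul_left, inner_smul_right, norm_mul, norm_mul, RCLike.norm_conj,
      Complex.norm_real, Complex.norm_real, Real.norm_of_nonneg (by positivity),
      Real.norm_of_nonneg (by positivity), inv_mul_le_iff₀ hφ, inv_mul_le_iff₀ hψ] at h
    linarith
  have hlim : Tendsto (fun ε : ℝ => 4 * c * (‖S φ‖ + ε) * (‖S ψ‖ + ε)) (𝓝[>] 0)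
      (𝓝 (4 * c * (‖S φ‖ + 0) * (‖S ψ‖ + 0))) :=
    (Continuous.tendsto (by fun_prop) 0).mono_left nhdsWithin_le_nhds
  simp only [add_zero] at hlim
  exact ge_of_tendsto hlim (eventually_mem_nhdsWithin.mono fun ε hε => h2 ε hε)

theorem ContinuousLinearMap.IsPositive.exists_adjoint_comp_self [CompleteSpace H]
    {T : H →L[ℂ] H} (hT : T.IsPositive) :
    ∃ S : H →L[ℂ] H, T = ContinuousLinearMap.adjoint S ∘L S := by
  have h := (ContinuousLinearMap.nonneg_iff_isPositive T).mpr hT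
  refine ⟨CFC.sqrt T, ?_⟩
  have h2 : IsSelfAdjoint (CFC.sqrt T) := (CFC.sqrt_nonneg T).isSelfAdjoint
  rw [h2.adjoint_eq]
  exact (CFC.sqrt_mul_sqrt_self T h).symm

end

namespace POVM

variable {X : Type*} [MeasurableSpace X] {H : Type*} [NormedAddCommGroup H]
  [InnerProductSpace ℂ H] [CompleteSpace H] (F : POVM X H)

theorem norm_inner_integral_self_le {g : X → ℂ} (hg : Measurable g) {c : ℝ}
    (hc : ∀ x, ‖g x‖ ≤ c) {X₀ : Set X} (hX₀ : MeasurableSet X₀) (hgX : ∀ x, x ∉ X₀ → g x = 0)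
    (ψ : H) : ‖inner ℂ ψ (F.integral g ψ)‖ ≤ c * (inner ℂ ψ (F.toFun X₀ ψ)).re := by
  rw [F.inner_integral hg hc, ← setIntegral_eq_integral_of_forall_compl_eq_zero hgX]
  refine (norm_setIntegral_le_of_norm_le_const (measure_lt_top _ _) fun x _ => hc x).trans_eq ?_
  rw [measureReal_def, F.quadMeasure_apply ψ hX₀, ENNReal.toReal_ofReal (F.re_nonneg hX₀ ψ)]

end POVM

/-! ### Characteristic functions -/

section

variable {X : Type*} [MeasurableSpace X] {H₁ H₂ : Type*}
  [NormedAddCommGroup H₁] [InnerProductSpace ℂ H₁] [CompleteSpace H₁]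
  [NormedAddCommGroup H₂] [InnerProductSpace ℂ H₂] [CompleteSpace H₂]

local postfix:max "†" => ContinuousLinearMap.adjoint

/-- The operator in the middle of `charOperator`. -/
noncomputable def charForm (F : POVM X H₁) (s : ℤ) (f : X → ℝ) : H₁ →L[ℂ] H₁ :=
  (-(s : ℂ)) • F.integral (fun x => Complex.exp (Complex.I * (f x : ℂ)) - 1)

theorem charOperator_eq (F : POVM X H₁) (s : ℤ) (W : H₂ →L[ℂ] H₁) (f : X → ℝ) :
    charOperator F s W f = W† ∘L charForm F s f ∘L W := by
  rw [charOperator, charForm, ContinuousLinearMap.smul_comp, ContinuousLinearMap.comp_smul]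

theorem measurable_exp_sub_one {f : X → ℝ} (hf : Measurable f) :
    Measurable fun x => Complex.exp (Complex.I * (f x : ℂ)) - 1 := by
  fun_prop

theorem norm_exp_sub_one_le (t : ℝ) : ‖Complex.exp (Complex.I * (t : ℂ)) - 1‖ ≤ 2 := by
  refine (norm_sub_le _ _).trans ?_
  rw [mul_comm, Complex.norm_exp_ofReal_mul_I, norm_one]
  norm_num

/-- `8 = 4 · 2`: polarization times `|e^{if} - 1| ≤ 2`. Independence of `f` is the source of the
uniformity. -/
theorem norm_inner_charForm_le (F : POVM X H₁) {X₀ : Set X} (hX₀ : MeasurableSet X₀) {s : ℤ}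
    (hs : s = 1 ∨ s = -1) {S : H₁ →L[ℂ] H₁} (hS : F.toFun X₀ = S† ∘L S) {f : X → ℝ}
    (hf : f ∈ testFunctions X₀) (φ ψ : H₁) :
    ‖inner ℂ φ (charForm F s f ψ)‖ ≤ 8 * ‖S φ‖ * ‖S ψ‖ := by
  have hs' : ‖(-(s : ℂ))‖ = 1 := by rcases hs with rfl | rfl <;> simp
  rw [charForm, smul_apply, inner_smul_right, norm_mul, hs', one_mul]
  refine (norm_inner_apply_le_of_norm_inner_apply_self_le S _ (c := 2) (fun χ => ?_)
    zero_le_two φ ψ).trans_eq (by norm_num)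
  refine (F.norm_inner_integral_self_le (measurable_exp_sub_one hf.1)
    (fun x => norm_exp_sub_one_le (f x)) hX₀ (fun x hx => by simp [hf.2 x hx]) χ).trans_eq ?_
  rw [hS, ContinuousLinearMap.comp_apply, ContinuousLinearMap.adjoint_inner_right]
  congr 1
  exact inner_self_eq_norm_sq (𝕜 := ℂ) (S χ)

/-- `Re(e^{if} - 1) = cos f - 1 ≤ 0`, and `-s = -1` reverses the sign. -/
theorem re_inner_charOperator_one_nonneg (F : POVM X H₁) (W : H₂ →L[ℂ] H₁) {f : X → ℝ}
    (hf : Measurable f) (x : H₂) : 0 ≤ (inner ℂ x (charOperator F 1 W f x)).re := by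
  have hint : Integrable (fun y => Complex.exp (Complex.I * (f y : ℂ)) - 1)
      (F.quadMeasure (W x)) :=
    Integrable.of_bound (measurable_exp_sub_one hf).aestronglyMeasurable 2
      (Eventually.of_forall fun y => norm_exp_sub_one_le (f y))
  rw [charOperator_eq, ContinuousLinearMap.comp_apply, ContinuousLinearMap.adjoint_inner_right,
    ContinuousLinearMap.comp_apply, charForm, smul_apply, inner_smul_right,
    F.inner_integral (measurable_exp_sub_one hf) (fun y => norm_exp_sub_one_le (f y))]
  have h : (∫ y, (Complex.exp (Complex.I * (f y : ℂ)) - 1) ∂(F.quadMeasure (W x))).re ≤ 0 := by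
    have h2 : (∫ y, (Complex.exp (Complex.I * (f y : ℂ)) - 1).re ∂(F.quadMeasure (W x)))
        = (∫ y, (Complex.exp (Complex.I * (f y : ℂ)) - 1) ∂(F.quadMeasure (W x))).re :=
      integral_re hint
    rw [← h2]
    refine integral_nonpos fun y => ?_
    simp only [Complex.sub_re, Complex.one_re, Pi.zero_apply, mul_comm Complex.I,
      Complex.exp_ofReal_mul_I_re]
    linarith [Real.cos_le_one (f y)]
  simpa using h

/-- Both sides say that `SW` is Hilbert-Schmidt, a property shared with the adjoint. This moves the
trace from bases of `H₂` to one fixed basis of `H₁`. -/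
theorem hasFiniteTrace_adjoint_comp_comp_iff {S : H₁ →L[ℂ] H₁} (W : H₂ →L[ℂ] H₁) {κ : Type*}
    (e : HilbertBasis κ ℂ H₁) :
    HasFiniteTrace (W† ∘L (S† ∘L S) ∘L W) ↔ Summable fun k => ‖W† (S† (e k))‖ ^ 2 := by
  have h : ∀ x, (inner ℂ x ((W† ∘L (S† ∘L S) ∘L W) x)).re = ‖(S ∘L W) x‖ ^ 2 := by
    intro x
    simp only [ContinuousLinearMap.comp_apply, ContinuousLinearMap.adjoint_inner_right]
    exact inner_self_eq_norm_sq (𝕜 := ℂ) (S (W x))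
  have h' : ∀ k, ‖(S ∘L W)† (e k)‖ ^ 2 = ‖W† (S† (e k))‖ ^ 2 := fun k => by
    simp [ContinuousLinearMap.adjoint_comp]
  simp only [HasFiniteTrace, h]
  constructor
  · intro hT
    obtain ⟨w, b, -⟩ := exists_hilbertBasis ℂ H₂
    have := summable_sq_norm_apply_of_adjoint b ((S ∘L W)†)
      (by simpa only [ContinuousLinearMap.adjoint_adjoint] using hT w b) e.orthonormal
    simpa only [h'] using this
  · intro hs w b
    exact summable_sq_norm_apply_of_adjoint e (S ∘L W) (by simpa only [h'] using hs) b.orthonormal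

theorem charFunctionDefined_of_summable (F : POVM X H₁) {X₀ : Set X} (hX₀ : MeasurableSet X₀)
    {s : ℤ} (hs : s = 1 ∨ s = -1) {S : H₁ →L[ℂ] H₁} (hS : F.toFun X₀ = S† ∘L S)
    {W : H₂ →L[ℂ] H₁} {κ : Type*} (e : HilbertBasis κ ℂ H₁)
    (hW : Summable fun k => ‖W† (S† (e k))‖ ^ 2) : CharFunctionDefined F X₀ s W := by
  intro f hf
  have hd : HasFredholmDet (charOperator F s W f) (fredholmDet (charOperator F s W f)) := by
    rw [charOperator_eq]
    exact hasFredholmDet_fredholmDet e (c := 8) (by norm_num)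
      (norm_inner_charForm_le F hX₀ hs hS hf) hW
  refine ⟨hd, ?_⟩
  rintro rfl
  rw [← norm_pos_iff]
  exact zero_lt_one.trans_le
    (one_le_norm_fredholmDet (re_inner_charOperator_one_nonneg F W hf.1) hd)

/-- For `s = 1`, inversion is 1-Lipschitz on numbers of modulus at least 1. -/
theorem norm_charFunction_sub_le (F : POVM X H₁) {X₀ : Set X}
    {s : ℤ} (hs : s = 1 ∨ s = -1) {W W' : H₂ →L[ℂ] H₁}
    (hW : CharFunctionDefined F X₀ s W) (hW' : CharFunctionDefined F X₀ s W') {f : X → ℝ}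
    (hf : f ∈ testFunctions X₀) {C : ℝ}
    (hC : ∀ v, ‖compressionDet (charOperator F s W' f) v - compressionDet (charOperator F s W f) v‖
      ≤ C) : ‖charFunction F s W' f - charFunction F s W f‖ ≤ C := by
  have h := le_of_tendsto ((hW' f hf).1.sub (hW f hf).1).norm (Eventually.of_forall hC)
  rcases hs with rfl | rfl
  · have h1 := one_le_norm_fredholmDet (re_inner_charOperator_one_nonneg F W hf.1) (hW f hf).1
    have h1' := one_le_norm_fredholmDet (re_inner_charOperator_one_nonneg F W' hf.1) (hW' f hf).1
    have h0 : fredholmDet (charOperator F 1 W f) ≠ 0 := (hW f hf).2 rfl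
    have h0' : fredholmDet (charOperator F 1 W' f) ≠ 0 := (hW' f hf).2 rfl
    simp only [charFunction, zpow_neg, zpow_one]
    rw [inv_sub_inv h0' h0, norm_div, norm_mul, norm_sub_rev]
    exact (div_le_self (norm_nonneg _) (one_le_mul_of_one_le_of_one_le h1' h1)).trans h
  · simpa [charFunction] using h

end

/-! ### The convergence theorem -/

theorem lemma2 {X : Type*} [MeasurableSpace X] {H₁ H₂ : Type*}
    [NormedAddCommGroup H₁] [InnerProductSpace ℂ H₁] [CompleteSpace H₁]
    [NormedAddCommGroup H₂] [InnerProductSpace ℂ H₂] [CompleteSpace H₂]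
    (F : POVM X H₁) (X₀ : Set X) (hX₀ : MeasurableSet X₀)
    (s : ℤ) (hs : s = 1 ∨ s = -1)
    (W₀ : H₂ →L[ℂ] H₁) (hW₀ : LocalizationCondition F X₀ s W₀)
    {ι : Type*} (l : Filter ι) [l.NeBot]
    (W : ι → H₂ →L[ℂ] H₁) (Winf : H₂ →L[ℂ] H₁)
    (hlim : ∀ ψ : H₁, Tendsto (fun α => ContinuousLinearMap.adjoint (W α) ψ) l
      (𝓝 (ContinuousLinearMap.adjoint Winf ψ)))
    (hle : ∀ α, W α ∘L ContinuousLinearMap.adjoint (W α) ≤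
      W₀ ∘L ContinuousLinearMap.adjoint W₀) :
    (LocalizationCondition F X₀ s Winf ∧ ∀ α, LocalizationCondition F X₀ s (W α)) ∧
    (CharFunctionDefined F X₀ s Winf ∧ ∀ α, CharFunctionDefined F X₀ s (W α)) ∧
    TendstoUniformlyOn (fun α f => charFunction F s (W α) f) (fun f => charFunction F s Winf f)
      l (testFunctions X₀) := by
  obtain ⟨S, hS⟩ := (F.isPositive X₀ hX₀).exists_adjoint_comp_self
  obtain ⟨w, e, -⟩ := exists_hilbertBasis ℂ H₁
  have hdom : ∀ α ψ, ‖ContinuousLinearMap.adjoint (W α) ψ‖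
      ≤ ‖ContinuousLinearMap.adjoint W₀ ψ‖ := by
    intro α ψ
    have h := ((ContinuousLinearMap.le_def _ _).mp (hle α)).re_inner_nonneg_right ψ
    simp only [sub_apply, inner_sub_right, ContinuousLinearMap.comp_apply, map_sub] at h
    rw [← ContinuousLinearMap.adjoint_inner_left W₀, ← ContinuousLinearMap.adjoint_inner_left (W α),
      inner_self_eq_norm_sq, inner_self_eq_norm_sq] at h
    exact (sq_le_sq₀ (norm_nonneg _) (norm_nonneg _)).mp (by linarith)
  have hdominf : ∀ ψ, ‖ContinuousLinearMap.adjoint Winf ψ‖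
      ≤ ‖ContinuousLinearMap.adjoint W₀ ψ‖ := fun ψ =>
    le_of_tendsto (hlim ψ).norm (Eventually.of_forall fun α => hdom α ψ)
  have hsum₀ := (hasFiniteTrace_adjoint_comp_comp_iff W₀ e).mp (hS ▸ hW₀.finite_trace)
  have hsum : ∀ V : H₂ →L[ℂ] H₁, (∀ ψ, ‖ContinuousLinearMap.adjoint V ψ‖
      ≤ ‖ContinuousLinearMap.adjoint W₀ ψ‖) → Summable fun k =>
        ‖ContinuousLinearMap.adjoint V (ContinuousLinearMap.adjoint S (e k))‖ ^ 2 :=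
    fun V hV => hsum₀.of_nonneg_of_le (fun _ => sq_nonneg _) fun k =>
      pow_le_pow_left₀ (norm_nonneg _) (hV _) 2
  have hloc : ∀ V : H₂ →L[ℂ] H₁, (∀ ψ, ‖ContinuousLinearMap.adjoint V ψ‖
      ≤ ‖ContinuousLinearMap.adjoint W₀ ψ‖) → LocalizationCondition F X₀ s V := by
    intro V hV
    refine ⟨hS ▸ (hasFiniteTrace_adjoint_comp_comp_iff V e).mpr (hsum V hV), fun h => ?_⟩
    refine lt_of_le_of_lt ?_ (hW₀.norm_lt_one h)
    rw [← LinearIsometryEquiv.norm_map ContinuousLinearMap.adjoint V,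
      ← LinearIsometryEquiv.norm_map ContinuousLinearMap.adjoint W₀]
    exact ContinuousLinearMap.opNorm_le_bound _ (norm_nonneg _) fun ψ =>
      (hV ψ).trans (ContinuousLinearMap.le_opNorm _ ψ)
  have hdef : ∀ V : H₂ →L[ℂ] H₁, (∀ ψ, ‖ContinuousLinearMap.adjoint V ψ‖
      ≤ ‖ContinuousLinearMap.adjoint W₀ ψ‖) → CharFunctionDefined F X₀ s V := fun V hV =>
    charFunctionDefined_of_summable F hX₀ hs hS e (hsum V hV)
  refine ⟨⟨hloc _ hdominf, fun α => hloc _ (hdom α)⟩,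
    ⟨hdef _ hdominf, fun α => hdef _ (hdom α)⟩, ?_⟩
  set β := ∑' k, ‖ContinuousLinearMap.adjoint Winf (ContinuousLinearMap.adjoint S (e k))‖ ^ 2
    with hβ
  have hdiff : ∀ α k, ‖ContinuousLinearMap.adjoint (W α) (ContinuousLinearMap.adjoint S (e k))
      - ContinuousLinearMap.adjoint Winf (ContinuousLinearMap.adjoint S (e k))‖ ^ 2
      ≤ 4 * ‖ContinuousLinearMap.adjoint W₀ (ContinuousLinearMap.adjoint S (e k))‖ ^ 2 := by
    intro α k
    calc _ ≤ (2 * ‖ContinuousLinearMap.adjoint W₀ (ContinuousLinearMap.adjoint S (e k))‖) ^ 2 := by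
          refine pow_le_pow_left₀ (norm_nonneg _) ((norm_sub_le _ _).trans ?_) 2
          linarith [hdom α (ContinuousLinearMap.adjoint S (e k)),
            hdominf (ContinuousLinearMap.adjoint S (e k))]
      _ = _ := by ring
  -- Dominated convergence in `k` with majorant `4‖W₀*S*eₖ‖²`; as a statement about sums over a
  -- fixed index set it holds along any filter, hence for nets.
  have htend : Tendsto (fun α => ∑' k, ‖ContinuousLinearMap.adjoint (W α)
      (ContinuousLinearMap.adjoint S (e k))
      - ContinuousLinearMap.adjoint Winf (ContinuousLinearMap.adjoint S (e k))‖ ^ 2) l (𝓝 0) := by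
    have h := tendsto_tsum_of_dominated_convergence (𝓕 := l)
      (f := fun α k => ‖ContinuousLinearMap.adjoint (W α) (ContinuousLinearMap.adjoint S (e k))
        - ContinuousLinearMap.adjoint Winf (ContinuousLinearMap.adjoint S (e k))‖ ^ 2)
      (g := fun _ => (0 : ℝ)) (hsum₀.mul_left 4) ?_ ?_
    · simpa using h
    · intro k
      have h := (((hlim (ContinuousLinearMap.adjoint S (e k))).sub_const
        (ContinuousLinearMap.adjoint Winf (ContinuousLinearMap.adjoint S (e k)))).norm).pow 2
      simpa using h
    · refine Eventually.of_forall fun α k => ?_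
      rw [Real.norm_of_nonneg (by positivity)]
      exact hdiff α k
  rw [Metric.tendstoUniformlyOn_iff]
  intro ε hε
  set C := 2 * Real.exp (8 * (2 * β + 2) + (8 * (2 * β + 2)) ^ 2 / 2)
  have hC : 0 < C := by positivity
  obtain ⟨δ, hδ0, hδ⟩ := exists_between (show 0 < min 1 (ε / C) by positivity)
  obtain ⟨hδ1, hδε⟩ := lt_min_iff.mp hδ
  filter_upwards [htend.eventually (eventually_lt_nhds (show 0 < δ ^ 2 by positivity))] with α hα
  intro f hf
  rw [dist_comm, dist_eq_norm]
  have hlt : C * δ < ε := by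
    calc C * δ < C * (ε / C) := by gcongr
      _ = ε := by field_simp
  refine (norm_charFunction_sub_le F hs (hdef _ hdominf) (hdef _ (hdom α)) hf fun v => ?_).trans_lt
    hlt
  rw [charOperator_eq, charOperator_eq]
  exact norm_compressionDet_sub_le e (by norm_num) (norm_inner_charForm_le F hX₀ hs hS hf)
    (hsum _ hdominf) hβ.symm.le
    ((hsum₀.mul_left 4).of_nonneg_of_le (fun _ => sq_nonneg _) (hdiff α)) hδ0 hδ1 hα.le v
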